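/- Let $\nu$ be a natural number, $\mathbb{F}_q$ a finite field with $q$ elements, and $K=\begin{pmatrix}0&I^{(\nu)}\\-I^{(\nu)}&0\end{pmatrix}$. A subspace $X$ of the space of row vectors $\mathbb{F}_q^{2\nu}$ is of type $t(X)=(m,s)$ if $\dim X=m$ and, for a matrix $P$ whose rows form a basis of $X$, the matrix $PK\,{}^tP$ has rank $2s$. The symplectic inner product graph $Spi(2\nu,q)$ has as vertices all subspaces of $\mathbb{F}_q^{2\nu}$ other than $0$ and $\mathbb{F}_q^{2\nu}$, with an edge $A$---$B$ between vertices $A$ and $B$ if and only if $\alpha K\,{}^t\beta=0$ for all $\alpha\in A$ and $\beta\in B$; edges are unordered, and $A=B$ is allowed (so $A$ carries a loop exactly when it is totally isotropic). An automorphism is a bijection of the vertex set that preserves adjacency in both directions; ${\rm Aut}(Spi(2\nu,q))$ acts on the edges by $\sigma(A\text{---}B)=\sigma(A)\text{---}\sigma(B)$. Let $X_1$---$X_2$ and $Y_1$---$Y_2$ be edges of $Spi(2\nu,q)$. Then they are in the same orbit under the action of ${\rm Aut}(Spi(2\nu,q))$ if and only if one of the following is true: (1) $t(X_1)=t(Y_1)$,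 $t(X_2)=t(Y_2)$, $t(X_1+X_2)=t(Y_1+Y_2)$; (2) $t(X_1)=t(Y_2)$, $t(X_2)=t(Y_1)$, $t(X_1+X_2)=t(Y_1+Y_2)$. -/

import Mathlib

open scoped Matrix

namespace SympInnerProduct

/-- Index set of the coordinates of `F^(2ν)`: `Sum.inl i` is the `i`-th and `Sum.inr i`
the `(ν+i)`-th coordinate. -/
abbrev Idx (ν : ℕ) : Type := Fin ν ⊕ Fin ν

/-- The matrix `K_{2ν}` with blocks `0, I` in the first and `-I, 0` in the second row. -/
def K (ν : ℕ) (F : Type*) [Field F] : Matrix (Idx ν) (Idx ν) F :=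
  Matrix.fromBlocks 0 1 (-1) 0

/-- The symplectic inner product `α K β^t` of row vectors. -/
def sip {ν : ℕ} {F : Type*} [Field F] (a b : Idx ν → F) : F :=
  a ⬝ᵥ (K ν F *ᵥ b)

/-- The matrix `P` is a matrix representation of the subspace `X`: its rows form a basis of `X`. -/
def IsMatrixRep {ν : ℕ} {F : Type*} [Field F] {m : ℕ} (P : Matrix (Fin m) (Idx ν) F)
    (X : Submodule F (Idx ν → F)) : Prop :=
  LinearIndependent F P.row ∧ Submodule.span F (Set.range P.row) = X

/-- The matrix representation of `X` given by a (chosen) basis of `X`. -/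
noncomputable def repMatrix {ν : ℕ} {F : Type*} [Field F] (X : Submodule F (Idx ν → F)) :
    Matrix (Fin (Module.finrank F X)) (Idx ν) F :=
  Matrix.of fun i => (Module.finBasis F X i : Idx ν → F)

/-- `X` is a subspace of type `(m, s)`: it is `m`-dimensional and `P K P^t` has rank `2s`, where
`P` is a matrix representation of `X`. -/
def IsOfType {ν : ℕ} {F : Type*} [Field F] (X : Submodule F (Idx ν → F)) (m s : ℕ) : Prop :=
  ∃ P : Matrix (Fin m) (Idx ν) F, IsMatrixRep P X ∧ (P * K ν F * Pᵀ).rank = 2 * s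

/-- The type `t(X) = (m, s)` of a subspace `X`; see `isOfType_iff` below (the rank that is
halved is always even, and does not depend on the matrix representation). -/
noncomputable def t {ν : ℕ} {F : Type*} [Field F] (X : Submodule F (Idx ν → F)) : ℕ × ℕ :=
  (Module.finrank F X, (repMatrix X * K ν F * (repMatrix X)ᵀ).rank / 2)

theorem sip_self {ν : ℕ} {F : Type*} [Field F] (a : Idx ν → F) : sip a a = 0 := by
  simp [sip, K, Matrix.mulVec, dotProduct, Matrix.one_apply, mul_comm]

theorem sip_neg {ν : ℕ} {F : Type*} [Field F] (a b : Idx ν → F) : - sip a b = sip b a := by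
  have h := sip_self (a + b)
  have ha := sip_self a
  have hb := sip_self b
  simp only [sip, Matrix.mulVec_add, add_dotProduct, dotProduct_add] at h ha hb ⊢
  linear_combination ha + hb - h

theorem isMatrixRep_repMatrix {ν : ℕ} {F : Type*} [Field F] (X : Submodule F (Idx ν → F)) :
    IsMatrixRep (repMatrix X) X := by
  have hrow : (repMatrix X).row = X.subtype ∘ Module.finBasis F X := rfl
  constructor
  · rw [hrow]
    exact (Module.finBasis F X).linearIndependent.map' _ (Submodule.ker_subtype X)
  · rw [hrow, Set.range_comp, Submodule.span_image, (Module.finBasis F X).span_eq]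
    simp

theorem exists_mul_eq {ν : ℕ} {F : Type*} [Field F] {m n : ℕ} {X : Submodule F (Idx ν → F)}
    {P : Matrix (Fin m) (Idx ν) F} {Q : Matrix (Fin n) (Idx ν) F}
    (hP : IsMatrixRep P X) (hQ : IsMatrixRep Q X) :
    ∃ U : Matrix (Fin m) (Fin n) F, P = U * Q := by
  have h : ∀ i, ∃ c : Fin n → F, ∑ j, c j • Q.row j = P.row i := by
    intro i
    rw [← Submodule.mem_span_range_iff_exists_fun, hQ.2, ← hP.2]
    exact Submodule.subset_span ⟨i, rfl⟩
  choose c hc using h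
  refine ⟨Matrix.of c, ?_⟩
  ext i k
  have := congrFun (hc i) k
  simp only [Finset.sum_apply, Pi.smul_apply, smul_eq_mul, Matrix.row_apply] at this
  simp [Matrix.mul_apply, this]

theorem rank_gram_le {ν : ℕ} {F : Type*} [Field F] {m n : ℕ} {X : Submodule F (Idx ν → F)}
    {P : Matrix (Fin m) (Idx ν) F} {Q : Matrix (Fin n) (Idx ν) F}
    (hP : IsMatrixRep P X) (hQ : IsMatrixRep Q X) :
    (P * K ν F * Pᵀ).rank ≤ (Q * K ν F * Qᵀ).rank := by
  obtain ⟨U, rfl⟩ := exists_mul_eq hP hQ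
  have : U * Q * K ν F * (U * Q)ᵀ = U * (Q * K ν F * Qᵀ) * Uᵀ := by
    simp only [Matrix.transpose_mul, Matrix.mul_assoc]
  rw [this]
  exact (Matrix.rank_mul_le_left _ _).trans (Matrix.rank_mul_le_right _ _)

theorem even_rank_gram {ν : ℕ} {F : Type*} [Field F] {m : ℕ} (P : Matrix (Fin m) (Idx ν) F) :
    Even (P * K ν F * Pᵀ).rank := by
  set A := P * K ν F * Pᵀ with hA
  let B : LinearMap.BilinForm F (Fin m → F) := Matrix.toBilin' A
  have hB : ∀ v w, B v w = v ⬝ᵥ (A *ᵥ w) := fun v w => Matrix.toBilin'_apply' A v w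
  have hAlt : B.IsAlt := by
    intro v
    have h := sip_self (v ᵥ* P)
    rw [hB, hA, ← Matrix.mulVec_mulVec, ← Matrix.mulVec_mulVec, Matrix.dotProduct_mulVec,
      Matrix.mulVec_transpose]
    exact h
  obtain ⟨W, hW, hmax⟩ := WellFounded.has_min
    (wellFounded_gt (α := Submodule F (Fin m → F)))
    {W | ∀ x ∈ W, ∀ y ∈ W, B x y = 0} ⟨⊥, by simp⟩
  have hperp : B.orthogonal W = W := by
    apply le_antisymm
    · intro x hx
      by_contra hxW
      refine hmax (W ⊔ Submodule.span F {x}) ?_ ?_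
      · intro y hy z hz
        obtain ⟨y', hy', c, rfl⟩ := by simpa [Submodule.mem_sup, Submodule.mem_span_singleton] using hy
        obtain ⟨z', hz', d, rfl⟩ := by simpa [Submodule.mem_sup, Submodule.mem_span_singleton] using hz
        have h1 : B y' x = 0 := hx y' hy'
        have h2 : B x z' = 0 := hAlt.isRefl _ _ (hx z' hz')
        simp [hW y' hy' z' hz', h1, h2, hAlt.self_eq_zero x]
      · refine lt_of_le_of_ne le_sup_left fun h => hxW ?_
        rw [h]
        exact Submodule.mem_sup_right (Submodule.mem_span_singleton_self x)
    · exact fun x hx y hy => hW y hy x hx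
  have hrad : B.orthogonal ⊤ = LinearMap.ker A.mulVecLin := by
    ext v
    simp only [LinearMap.BilinForm.mem_orthogonal_iff, hB,
      Submodule.mem_top, true_implies, LinearMap.mem_ker, Matrix.mulVecLin_apply]
    exact ⟨fun h => dotProduct_eq_zero _ (fun w => by rw [dotProduct_comm]; exact h w),
      fun h w => by rw [h, dotProduct_zero]⟩
  have hle : B.orthogonal ⊤ ≤ W := by
    rw [← hperp]
    exact LinearMap.BilinForm.orthogonal_le le_top
  have h1 := LinearMap.BilinForm.finrank_add_finrank_orthogonal hAlt.isRefl W
  have h2 := LinearMap.finrank_range_add_finrank_ker A.mulVecLin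
  rw [hperp, inf_eq_right.2 hle, hrad] at h1
  have h3 : A.rank = Module.finrank F (LinearMap.range A.mulVecLin) := rfl
  rw [h3]
  exact ⟨Module.finrank F W - Module.finrank F (LinearMap.ker A.mulVecLin), by omega⟩

/-- `t X` is the one and only pair `(m, s)` such that `X` is of type `(m, s)`. -/
theorem isOfType_iff {ν : ℕ} {F : Type*} [Field F] (X : Submodule F (Idx ν → F)) (m s : ℕ) :
    IsOfType X m s ↔ t X = (m, s) := by
  have hrep := isMatrixRep_repMatrix X
  have heven := Nat.div_two_mul_two_of_even (even_rank_gram (repMatrix X))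
  constructor
  · rintro ⟨P, hP, hr⟩
    have hm : Module.finrank F X = m := by
      rw [← hP.2, finrank_span_eq_card hP.1, Fintype.card_fin]
    have := le_antisymm (rank_gram_le hP hrep) (rank_gram_le hrep hP)
    refine Prod.ext hm ?_
    show _ / 2 = s
    omega
  · intro h
    obtain ⟨rfl, rfl⟩ := Prod.mk.inj h
    exact ⟨repMatrix X, hrep, by omega⟩

/-- The vertices of the graph: the non-trivial subspaces, neither `0` nor the whole space. -/
abbrev Vertex (ν : ℕ) (F : Type*) [Field F] : Type _ :=
  {X : Submodule F (Idx ν → F) // X ≠ ⊥ ∧ X ≠ ⊤}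

/-- Adjacency in the symplectic inner product graph: `A K B^t = 0`. Loops are part of the graph:
a totally isotropic subspace is adjacent to itself. -/
def Adj {ν : ℕ} {F : Type*} [Field F] (A B : Vertex ν F) : Prop :=
  ∀ a ∈ A.1, ∀ b ∈ B.1, sip a b = 0

theorem adj_symm (ν : ℕ) (F : Type*) [Field F] :
    Std.Symm (Adj : Vertex ν F → Vertex ν F → Prop) :=
  ⟨fun A B h b hb a ha => by rw [← sip_neg, h a ha b hb, neg_zero]⟩

/-- The edges: the unordered pairs (possibly loops) of adjacent vertices. -/
abbrev Edge (ν : ℕ) (F : Type*) [Field F] : Type _ :=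
  {e : Sym2 (Vertex ν F) // e ∈ Sym2.fromRel (adj_symm ν F)}

/-- The edge between two adjacent vertices. -/
def mkEdge {ν : ℕ} {F : Type*} [Field F] {A B : Vertex ν F} (h : Adj A B) : Edge ν F :=
  ⟨s(A, B), Sym2.fromRel_prop.2 h⟩

/-- The automorphism group of the graph: the bijections of the vertex set that preserve
adjacency in both directions, under composition. -/
abbrev AutSpi (ν : ℕ) (F : Type*) [Field F] : Type _ :=
  (Adj : Vertex ν F → Vertex ν F → Prop) ≃r (Adj : Vertex ν F → Vertex ν F → Prop)

/-- The natural action of the automorphism group on the edges. -/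
instance edgeAction (ν : ℕ) (F : Type*) [Field F] : MulAction (AutSpi ν F) (Edge ν F) where
  smul σ e := ⟨Sym2.map σ e.1, by
    obtain ⟨e, he⟩ := e
    induction e with
    | _ A B => exact Sym2.fromRel_prop.2 (σ.map_rel_iff.2 (Sym2.fromRel_prop.1 he))⟩
  one_smul e := Subtype.ext (congrFun Sym2.map_id e.1)
  mul_smul σ τ e := Subtype.ext (Sym2.map_map (g := σ) (f := τ) e.1).symm

/-- An automorphism sends the edge `A`---`B` to the edge `σ A`---`σ B`. -/
theorem smul_mkEdge {ν : ℕ} {F : Type*} [Field F] (σ : AutSpi ν F) {A B : Vertex ν F}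
    (h : Adj A B) : σ • mkEdge h = mkEdge (σ.map_rel_iff.2 h) := rfl

end SympInnerProduct

/-! Inclusion can be read off from adjacency: since `A` is its own double perp, `A ≤ C` means that
every neighbour of `C` is a neighbour of `A` (`le_iff_adj_imp`). So a graph automorphism extends to
an automorphism of the whole subspace lattice (`latticeAut`), where `X₁ ⊔ X₂` makes sense even if it
is the full space. It preserves dimension, which is height, and commutes with perp, so it preserves
the dimension of the radical `X ⊓ X^⊥`. By `t_eq_iff` these two dimensions determine the type.

Conversely, if the types match, the dimension formula gives equal dimensions for `X₁ ⊓ X₂` and `Y₁ ⊓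
Y₂`. As the pairs are orthogonal, each intersection lies in both radicals, so any linear isomorphism
between the intersections extends to isometries `X₁ → Y₁` and `X₂ → Y₂`. These glue to an isometry
of the sums, which Witt's theorem extends to the whole space.

Witt's theorem is proved for degenerate forms because it serves twice: inside each `Xᵢ`, starting
from the radical, and in the nondegenerate ambient space. -/

open Module
open LinearMap (BilinForm)

/-! ### Witt extension for alternating forms -/

namespace LinearMap.BilinForm

variable {F V V' : Type*} [Field F] [AddCommGroup V] [Module F V] [AddCommGroup V'] [Module F V']
  [FiniteDimensional F V] [FiniteDimensional F V']

/-- An injective partial linear map between spaces with bilinear forms that preserves the forms,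
is defined on the radical of the first form and hits the radical of the second, and matches
the two radicals. -/
structure IsPartialIsometry (B : BilinForm F V) (B' : BilinForm F V') (f : V →ₗ.[F] V') :
    Prop where
  injective : Function.Injective f.toFun
  map_form : ∀ x y : f.domain, B' (f x) (f y) = B x y
  ker_le_domain : LinearMap.ker B ≤ f.domain
  ker_le_range : LinearMap.ker B' ≤ LinearMap.range f.toFun
  map_ker : ∀ x : f.domain, B x = 0 ↔ B' (f x) = 0

/-- The admissible images of `v` form a coset of the orthogonal of the range. If the range swallowed
this coset, a dimension count would put the orthogonal of the domain inside the domain, and `v` with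
it. -/
theorem IsPartialIsometry.exists_notMem_range {B : BilinForm F V} {B' : BilinForm F V'}
    (hdim : finrank F V = finrank F V') {f : V →ₗ.[F] V'} (hf : IsPartialIsometry B B' f)
    {v : V} (hv : v ∉ f.domain) :
    ∃ v' ∉ LinearMap.range f.toFun, ∀ x : f.domain, B' (f x) v' = B x v := by
  have hker : LinearMap.ker (B ∘ₗ f.domain.subtype) = LinearMap.ker (B' ∘ₗ f.toFun) := by
    ext x
    exact hf.map_ker x
  -- The functional `x ↦ B x v` kills the common kernel, so it factors through `B' ∘ f`.
  have hmem : (B ∘ₗ f.domain.subtype).dualMap (Dual.eval F V v) ∈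
      LinearMap.range (B' ∘ₗ f.toFun).dualMap := by
    rw [LinearMap.range_dualMap_eq_dualAnnihilator_ker, ← hker,
      ← LinearMap.range_dualMap_eq_dualAnnihilator_ker]
    exact ⟨_, rfl⟩
  obtain ⟨ξ, hξ⟩ := hmem
  obtain ⟨v₀, rfl⟩ := (evalEquiv F V').surjective ξ
  have hv₀ : ∀ x : f.domain, B' (f x) v₀ = B x v := fun x => LinearMap.congr_fun hξ x
  by_contra! hcon
  have key : ∀ u ∈ B'.orthogonal (LinearMap.range f.toFun), v₀ + u ∈ LinearMap.range f.toFun := by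
    intro u hu
    by_contra h
    obtain ⟨x, hx⟩ := hcon _ h
    have h0 : B' (f x) u = 0 := hu _ ⟨x, rfl⟩
    exact hx (by rw [map_add, hv₀, h0, add_zero])
  have hv₀mem : v₀ ∈ LinearMap.range f.toFun := by simpa using key 0 (Submodule.zero_mem _)
  have hle' : B'.orthogonal (LinearMap.range f.toFun) ≤ LinearMap.range f.toFun := fun u hu => by
    simpa using Submodule.sub_mem _ (key u hu) hv₀mem
  have hfin : ∀ N : Submodule F f.domain,
      finrank F (N.map f.domain.subtype) = finrank F (N.map f.toFun) := fun N => by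
    rw [Submodule.finrank_map_subtype_eq]
    exact (Submodule.equivMapOfInjective f.toFun hf.injective N).finrank_eq
  have h1 : finrank F f.domain = finrank F (LinearMap.range f.toFun) := by
    have := hfin ⊤
    rwa [Submodule.map_subtype_top, Submodule.map_top] at this
  have h2 : finrank F (f.domain ⊓ LinearMap.ker B : Submodule F V) =
      finrank F (LinearMap.range f.toFun ⊓ LinearMap.ker B' : Submodule F V') := by
    have := hfin (LinearMap.ker (B ∘ₗ f.domain.subtype))
    conv_rhs at this => rw [hker]
    rwa [LinearMap.ker_comp, LinearMap.ker_comp, Submodule.map_comap_subtype,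
      Submodule.map_comap_eq] at this
  have hperp : (B.orthogonal f.domain).comap f.domain.subtype =
      (B'.orthogonal (LinearMap.range f.toFun)).comap f.toFun := by
    ext x
    constructor
    · rintro h _ ⟨y, rfl⟩
      exact (hf.map_form y x).trans (h y y.2)
    · intro h y hy
      exact (hf.map_form ⟨y, hy⟩ x).symm.trans (h _ ⟨⟨y, hy⟩, rfl⟩)
  have h3 : finrank F (f.domain ⊓ B.orthogonal f.domain : Submodule F V) =
      finrank F (B'.orthogonal (LinearMap.range f.toFun)) := by
    have := hfin ((B.orthogonal f.domain).comap f.domain.subtype)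
    conv_rhs at this => rw [hperp]
    rwa [Submodule.map_comap_subtype, Submodule.map_comap_eq, inf_eq_right.2 hle'] at this
  have h4 := finrank_add_finrank_orthogonal' (B := B) f.domain
  have h5 := finrank_add_finrank_orthogonal' (B := B') (LinearMap.range f.toFun)
  have hle : B.orthogonal f.domain ≤ f.domain :=
    inf_eq_right.1 (Submodule.eq_of_le_of_finrank_eq inf_le_right (by omega))
  obtain ⟨w, hw⟩ := hv₀mem
  refine hv ?_
  -- `v` and the preimage `w` of `v₀` pair equally with the domain, so they differ by an element of
  -- its orthogonal.
  have hvw : v - w ∈ f.domain := hle fun x hx => by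
    have h := hf.map_form ⟨x, hx⟩ w
    have h' := hv₀ ⟨x, hx⟩
    rw [← hw] at h'
    rw [map_sub, sub_eq_zero]
    exact h'.symm.trans h
  simpa using Submodule.add_mem _ hvw w.2

/-- Sending `v` to `v'` works because both forms are alternating: `v'` has to satisfy only the
linear conditions, with none on `B' v' v'`. -/
theorem IsPartialIsometry.exists_extend_singleton {B : BilinForm F V} {B' : BilinForm F V'}
    (hB : B.IsAlt) (hB' : B'.IsAlt) (hdim : finrank F V = finrank F V') {f : V →ₗ.[F] V'}
    (hf : IsPartialIsometry B B' f) {v : V} (hv : v ∉ f.domain) :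
    ∃ g : V →ₗ.[F] V', IsPartialIsometry B B' g ∧ f ≤ g ∧ v ∈ g.domain := by
  obtain ⟨v', hv', h⟩ := hf.exists_notMem_range hdim hv
  have hle : f ≤ f.supSpanSingleton v v' hv := LinearPMap.left_le_sup _ _ _
  have hrep : ∀ x : (f.supSpanSingleton v v' hv).domain, ∃ (a : f.domain) (c : F),
      (x : V) = a + c • v ∧ f.supSpanSingleton v v' hv x = f a + c • v' := by
    rintro ⟨x, hx⟩
    obtain ⟨a, ha, y, hy, rfl⟩ := Submodule.mem_sup.1 hx
    obtain ⟨c, rfl⟩ := Submodule.mem_span_singleton.1 hy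
    exact ⟨⟨a, ha⟩, c, rfl, LinearPMap.supSpanSingleton_apply_mk f v v' hv a ha c⟩
  have hcoeff : ∀ (a : f.domain) (c : F), f a + c • v' ∈ LinearMap.range f.toFun → c = 0 := by
    intro a c hac
    by_contra hc
    refine hv' ?_
    have h1 : c • v' ∈ LinearMap.range f.toFun := by
      simpa using Submodule.sub_mem _ hac (LinearMap.mem_range_self f.toFun a)
    exact (Submodule.smul_mem_iff _ hc).1 h1
  have hcoeff' : ∀ (a : f.domain) (c : F), (a : V) + c • v ∈ f.domain → c = 0 := by
    intro a c hac
    by_contra hc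
    exact hv ((Submodule.smul_mem_iff _ hc).1 ((Submodule.add_mem_iff_right _ a.2).1 hac))
  refine ⟨f.supSpanSingleton v v' hv, ⟨?_, ?_, ?_, ?_, ?_⟩, hle,
    Submodule.mem_sup_right (Submodule.mem_span_singleton_self v)⟩
  · rw [← LinearMap.ker_eq_bot, LinearMap.ker_eq_bot']
    intro x hx
    obtain ⟨a, c, hxa, hgx⟩ := hrep x
    have hx' : f a + c • v' = 0 := hgx.symm.trans hx
    obtain rfl := hcoeff a c (hx' ▸ Submodule.zero_mem _)
    rw [zero_smul, add_zero] at hx' hxa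
    have : a = 0 := hf.injective (hx'.trans (map_zero f.toFun).symm)
    exact Subtype.ext (by rw [hxa, this]; rfl)
  · intro x y
    obtain ⟨a, c, hxa, hgx⟩ := hrep x
    obtain ⟨b, d, hyb, hgy⟩ := hrep y
    have e1 := h a
    have e2 : B' v' (f b) = B v b := by rw [← hB'.neg_eq, h, hB.neg_eq]
    simp only [hgx, hgy, hxa, hyb, map_add, map_smul, LinearMap.add_apply, LinearMap.smul_apply,
      hf.map_form, e1, e2, hB.self_eq_zero, hB'.self_eq_zero]
  · exact hf.ker_le_domain.trans hle.1
  · intro y hy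
    obtain ⟨a, rfl⟩ := hf.ker_le_range hy
    exact ⟨⟨a, hle.1 a.2⟩, (hle.2 (x := a) (y := ⟨a, hle.1 a.2⟩) rfl).symm⟩
  · intro x
    obtain ⟨a, c, hxa, hgx⟩ := hrep x
    rw [hgx, hxa]
    constructor
    · intro h0
      obtain rfl := hcoeff' a c (hf.ker_le_domain h0)
      simpa [hf.map_ker a] using h0
    · intro h0
      obtain rfl := hcoeff a c (hf.ker_le_range h0)
      simpa [hf.map_ker a] using h0

/-- **Witt's extension theorem** for alternating, possibly degenerate forms. -/
theorem IsPartialIsometry.exists_linearEquiv {B : BilinForm F V} {B' : BilinForm F V'}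
    (hB : B.IsAlt) (hB' : B'.IsAlt) (hdim : finrank F V = finrank F V') {f : V →ₗ.[F] V'}
    (hf : IsPartialIsometry B B' f) :
    ∃ e : V ≃ₗ[F] V', (∀ x y, B' (e x) (e y) = B x y) ∧ ∀ x : f.domain, e x = f x := by
  induction hn : finrank F V - finrank F f.domain using Nat.strong_induction_on generalizing f with
  | _ n ih =>
    by_cases htop : f.domain = ⊤
    · let φ : V →ₗ[F] V' := f.toFun ∘ₗ LinearMap.id.codRestrict f.domain (by simp [htop])
      have hφ : Function.Injective φ := by
        refine hf.injective.comp fun x y hxy => ?_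
        simpa using congrArg Subtype.val hxy
      refine ⟨φ.linearEquivOfInjective hφ hdim, fun x y => ?_, fun x => ?_⟩
      · exact hf.map_form ⟨x, by simp [htop]⟩ ⟨y, by simp [htop]⟩
      · rfl
    · obtain ⟨v, hv⟩ : ∃ v, v ∉ f.domain := by
        by_contra! h
        exact htop (eq_top_iff.2 fun v _ => h v)
      obtain ⟨g, hg, hfg, hvg⟩ := hf.exists_extend_singleton hB hB' hdim hv
      have hlt : finrank F f.domain < finrank F g.domain :=
        Submodule.finrank_lt_finrank_of_lt (lt_of_le_of_ne hfg.1 fun h => hv (h ▸ hvg))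
      have hle := Submodule.finrank_le g.domain
      obtain ⟨e, he, heg⟩ := ih _ (by omega) hg rfl
      exact ⟨e, he, fun x => (heg ⟨x, hfg.1 x.2⟩).trans (hfg.2 (x := x) rfl).symm⟩

end LinearMap.BilinForm

theorem Submodule.exists_linearEquiv_extend {F E E' : Type*} [Field F] [AddCommGroup E]
    [Module F E] [AddCommGroup E'] [Module F E'] [FiniteDimensional F E] [FiniteDimensional F E']
    (hdim : finrank F E = finrank F E') (D : Submodule F E) (g : D →ₗ[F] E')
    (hg : Function.Injective g) : ∃ h : E ≃ₗ[F] E', ∀ d : D, h d = g d := by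
  obtain ⟨C, hC⟩ := D.exists_isCompl
  obtain ⟨C', hC'⟩ := (LinearMap.range g).exists_isCompl
  have h1 := Submodule.finrank_add_eq_of_isCompl hC
  have h2 := Submodule.finrank_add_eq_of_isCompl hC'
  have h3 := LinearMap.finrank_range_of_inj hg
  let k : C ≃ₗ[F] C' := LinearEquiv.ofFinrankEq _ _ (by omega)
  let e := (D.prodEquivOfIsCompl C hC).symm ≪≫ₗ
    ((LinearEquiv.ofInjective g hg).prodCongr k) ≪≫ₗ
      (LinearMap.range g).prodEquivOfIsCompl C' hC'
  exact ⟨e, fun d => by simp [e]⟩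

/-! ### Isometries prescribed on the radical, and gluing -/

namespace LinearMap.BilinForm

variable {F V V' : Type*} [Field F] [AddCommGroup V] [Module F V] [AddCommGroup V'] [Module F V']
  [FiniteDimensional F V] [FiniteDimensional F V']

/-- Spaces with alternating forms of equal dimension and equal rank are isometric, where the
isometry may be prescribed on a subspace of the radical. -/
theorem exists_isometry_extending_of_le_ker {B : BilinForm F V} {B' : BilinForm F V'}
    (hB : B.IsAlt) (hB' : B'.IsAlt) (hdim : finrank F V = finrank F V')
    (hker : finrank F (LinearMap.ker B) = finrank F (LinearMap.ker B'))
    {D : Submodule F V} (hD : D ≤ LinearMap.ker B) (g : D →ₗ[F] V') (hg : Function.Injective g)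
    (hgker : ∀ d, g d ∈ LinearMap.ker B') :
    ∃ e : V ≃ₗ[F] V', (∀ x y, B' (e x) (e y) = B x y) ∧ ∀ d : D, e d = g d := by
  obtain ⟨h, hh⟩ := Submodule.exists_linearEquiv_extend hker (D.comap (LinearMap.ker B).subtype)
    ((g ∘ₗ (Submodule.comapSubtypeEquivOfLe hD).toLinearMap).codRestrict _ fun d => hgker _)
    (by
      intro x y hxy
      exact (Submodule.comapSubtypeEquivOfLe hD).injective (hg (congrArg Subtype.val hxy)))
  -- Both forms vanish on their radicals, so any linear isomorphism of the radicals is a partial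
  -- isometry.
  have hf : IsPartialIsometry B B' ⟨LinearMap.ker B, (LinearMap.ker B').subtype ∘ₗ h.toLinearMap⟩ :=
    { injective := Subtype.val_injective.comp h.injective
      map_form := fun x y => by
        have hx : B x = 0 := x.2
        have hx' : B' (h x) = 0 := (h x).2
        exact (LinearMap.congr_fun hx' _).trans (LinearMap.congr_fun hx _).symm
      ker_le_domain := le_rfl
      ker_le_range := fun y hy => ⟨h.symm ⟨y, hy⟩, by simp⟩
      map_ker := fun x => iff_of_true x.2 (h x).2 }
  obtain ⟨e, he, heh⟩ := hf.exists_linearEquiv hB hB' hdim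
  refine ⟨e, he, fun d => (heh ⟨d, hD d.2⟩).trans ?_⟩
  exact congrArg Subtype.val (hh ⟨⟨d, hD d.2⟩, d.2⟩)

end LinearMap.BilinForm
namespace LinearMap.BilinForm

variable {F V : Type*} [Field F] [AddCommGroup V] [Module F V]

theorem map_subtype_ker_restrict {B : BilinForm F V} (hB : B.IsAlt) (X : Submodule F V) :
    (LinearMap.ker (B.restrict X)).map X.subtype = X ⊓ B.orthogonal X := by
  ext x
  constructor
  · rintro ⟨x, hx, rfl⟩
    exact ⟨x.2, fun y hy => hB.isRefl _ _ (LinearMap.congr_fun hx ⟨y, hy⟩)⟩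
  · rintro ⟨hx, hx'⟩
    exact ⟨⟨x, hx⟩, LinearMap.ext fun y => hB.isRefl _ _ (hx' y y.2), rfl⟩

theorem finrank_ker_restrict {B : BilinForm F V} (hB : B.IsAlt) (X : Submodule F V) :
    finrank F (LinearMap.ker (B.restrict X)) = finrank F (X ⊓ B.orthogonal X : Submodule F V) := by
  rw [← map_subtype_ker_restrict hB, Submodule.finrank_map_subtype_eq]

variable [FiniteDimensional F V]

theorem exists_isometry_restrict_extending {B : BilinForm F V} (hB : B.IsAlt)
    {X Y D D' : Submodule F V} (hdim : finrank F X = finrank F Y)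
    (hrad : finrank F (X ⊓ B.orthogonal X : Submodule F V) =
      finrank F (Y ⊓ B.orthogonal Y : Submodule F V))
    (hDX : D ≤ X) (hD : D ≤ B.orthogonal X) (hDY : D' ≤ Y) (hD' : D' ≤ B.orthogonal Y)
    (k : D ≃ₗ[F] D') :
    ∃ e : X ≃ₗ[F] Y, (∀ x y, B (e x) (e y) = B x y) ∧
      ∀ (d : V) (hd : d ∈ D), (e ⟨d, hDX hd⟩ : V) = k ⟨d, hd⟩ := by
  have hBr : ∀ Z : Submodule F V, (B.restrict Z).IsAlt := fun Z z => hB z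
  obtain ⟨e, he, hek⟩ := exists_isometry_extending_of_le_ker (hBr X) (hBr Y) hdim
    (by rw [finrank_ker_restrict hB, finrank_ker_restrict hB, hrad])
    (D := D.comap X.subtype)
    (fun x hx => LinearMap.ext fun y => hB.isRefl _ _ (hD hx y y.2))
    (Submodule.inclusion hDY ∘ₗ k.toLinearMap ∘ₗ
      (Submodule.comapSubtypeEquivOfLe hDX).toLinearMap)
    ((Submodule.inclusion_injective hDY).comp
      (k.injective.comp (Submodule.comapSubtypeEquivOfLe hDX).injective))
    (fun d => LinearMap.ext fun y => hB.isRefl _ _ (hD' (k _).2 y y.2))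
  exact ⟨e, he, fun d hd => congrArg Subtype.val (hek ⟨⟨d, hDX hd⟩, hd⟩)⟩

/-- Two pairs of mutually orthogonal subspaces of a nondegenerate alternating space are related by
an isometry if the dimensions of the subspaces, of their radicals and of their intersections
agree. -/
theorem exists_isometry_map_eq_of_orthogonal {B : BilinForm F V} (hB : B.IsAlt)
    (hker : LinearMap.ker B = ⊥) {X₁ X₂ Y₁ Y₂ : Submodule F V}
    (hX : ∀ x ∈ X₁, ∀ y ∈ X₂, B x y = 0) (hY : ∀ x ∈ Y₁, ∀ y ∈ Y₂, B x y = 0)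
    (h₁ : finrank F X₁ = finrank F Y₁) (h₂ : finrank F X₂ = finrank F Y₂)
    (hinf : finrank F (X₁ ⊓ X₂ : Submodule F V) = finrank F (Y₁ ⊓ Y₂ : Submodule F V))
    (hrad₁ : finrank F (X₁ ⊓ B.orthogonal X₁ : Submodule F V) =
      finrank F (Y₁ ⊓ B.orthogonal Y₁ : Submodule F V))
    (hrad₂ : finrank F (X₂ ⊓ B.orthogonal X₂ : Submodule F V) =
      finrank F (Y₂ ⊓ B.orthogonal Y₂ : Submodule F V)) :
    ∃ e : V ≃ₗ[F] V, (∀ x y, B (e x) (e y) = B x y) ∧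
      X₁.map e.toLinearMap = Y₁ ∧ X₂.map e.toLinearMap = Y₂ := by
  have hX' : ∀ x ∈ X₂, ∀ y ∈ X₁, B x y = 0 := fun x hx y hy => hB.isRefl _ _ (hX y hy x hx)
  have hY' : ∀ x ∈ Y₂, ∀ y ∈ Y₁, B x y = 0 := fun x hx y hy => hB.isRefl _ _ (hY y hy x hx)
  -- An arbitrary `k` will do, since orthogonality puts the intersections in the radicals. Using the
  -- same `k` twice makes `e₁` and `e₂` agree on the overlap.
  let k : (X₁ ⊓ X₂ : Submodule F V) ≃ₗ[F] (Y₁ ⊓ Y₂ : Submodule F V) :=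
    LinearEquiv.ofFinrankEq _ _ hinf
  obtain ⟨e₁, he₁, hk₁⟩ := exists_isometry_restrict_extending hB h₁ hrad₁ inf_le_left
    (fun x hx y hy => hX y hy x hx.2) inf_le_left (fun x hx y hy => hY y hy x hx.2) k
  obtain ⟨e₂, he₂, hk₂⟩ := exists_isometry_restrict_extending hB h₂ hrad₂ inf_le_right
    (fun x hx y hy => hX' y hy x hx.1) inf_le_right (fun x hx y hy => hY' y hy x hx.1) k
  let f₁ : V →ₗ.[F] V := ⟨X₁, Y₁.subtype ∘ₗ e₁.toLinearMap⟩
  let f₂ : V →ₗ.[F] V := ⟨X₂, Y₂.subtype ∘ₗ e₂.toLinearMap⟩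
  have hagree : ∀ (x : f₁.domain) (y : f₂.domain), (x : V) = y → f₁ x = f₂ y := by
    rintro ⟨x, hx⟩ ⟨y, hy⟩ (rfl : x = y)
    exact (hk₁ x ⟨hx, hy⟩).trans (hk₂ x ⟨hx, hy⟩).symm
  have hrep : ∀ z : (f₁.sup f₂ hagree).domain, ∃ (x : X₁) (y : X₂),
      (z : V) = x + y ∧ f₁.sup f₂ hagree z = e₁ x + e₂ y := by
    rintro ⟨z, hz⟩
    obtain ⟨x, hx, y, hy, rfl⟩ := Submodule.mem_sup.1 hz
    exact ⟨⟨x, hx⟩, ⟨y, hy⟩, rfl, LinearPMap.sup_apply hagree ⟨x, hx⟩ ⟨y, hy⟩ _ rfl⟩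
  have hinj : Function.Injective (f₁.sup f₂ hagree).toFun := by
    rw [← LinearMap.ker_eq_bot, LinearMap.ker_eq_bot']
    intro z hz
    obtain ⟨x, y, hxy, hfz⟩ := hrep z
    have h0 : (e₁ x : V) + e₂ y = 0 := hfz.symm.trans hz
    -- If `e₁ x = -e₂ y`, this vector comes through `k` from some `d` in `X₁ ⊓ X₂`; then `x = d` and
    -- `y = -d`.
    have hmem : (e₁ x : V) ∈ Y₁ ⊓ Y₂ :=
      ⟨(e₁ x).2, by rw [eq_neg_of_add_eq_zero_left h0]; exact Y₂.neg_mem (e₂ y).2⟩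
    obtain ⟨⟨d, hd⟩, hkd⟩ := k.surjective ⟨_, hmem⟩
    have hd₁ : (e₁ ⟨d, hd.1⟩ : V) = e₁ x := (hk₁ d hd).trans (congrArg Subtype.val hkd)
    have hd₂ : (e₂ ⟨d, hd.2⟩ : V) = e₁ x := (hk₂ d hd).trans (congrArg Subtype.val hkd)
    obtain rfl := e₁.injective (Subtype.ext hd₁)
    rw [← hd₂] at h0
    have h0' : (⟨d, hd.2⟩ : X₂) + y = 0 :=
      e₂.injective (by rw [map_add, map_zero]; exact Subtype.ext h0)
    exact Subtype.ext (hxy.trans (congrArg Subtype.val h0'))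
  have hf : IsPartialIsometry B B (f₁.sup f₂ hagree) :=
    { injective := hinj
      map_form := fun z w => by
        obtain ⟨x, y, hz, hfz⟩ := hrep z
        obtain ⟨x', y', hw, hfw⟩ := hrep w
        rw [hz, hw, hfz, hfw]
        simp only [map_add, LinearMap.add_apply, he₁, he₂, hX _ x.2 _ y'.2, hX' _ y.2 _ x'.2,
          hY _ (e₁ x).2 _ (e₂ y').2, hY' _ (e₂ y).2 _ (e₁ x').2]
      ker_le_domain := by simp [hker]
      ker_le_range := by simp [hker]
      map_ker := fun z => by
        rw [← LinearMap.mem_ker, ← LinearMap.mem_ker, hker, Submodule.mem_bot, Submodule.mem_bot]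
        exact ⟨fun h => (congrArg (f₁.sup f₂ hagree).toFun (Subtype.ext h : z = 0)).trans (map_zero _),
          fun h => congrArg Subtype.val (hinj (h.trans (map_zero (f₁.sup f₂ hagree).toFun).symm))⟩ }
  obtain ⟨e, he, hef⟩ := hf.exists_linearEquiv hB hB rfl
  have hle₁ := LinearPMap.left_le_sup f₁ f₂ hagree
  have hle₂ := LinearPMap.right_le_sup f₁ f₂ hagree
  refine ⟨e, he, Submodule.eq_of_le_of_finrank_eq ?_ ((e.finrank_map_eq X₁).trans h₁),
    Submodule.eq_of_le_of_finrank_eq ?_ ((e.finrank_map_eq X₂).trans h₂)⟩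
  · rintro _ ⟨x, hx, rfl⟩
    have : e x = e₁ ⟨x, hx⟩ := (hef ⟨x, hle₁.1 hx⟩).trans (hle₁.2 (x := ⟨x, hx⟩) rfl).symm
    exact this ▸ (e₁ ⟨x, hx⟩).2
  · rintro _ ⟨x, hx, rfl⟩
    have : e x = e₂ ⟨x, hx⟩ := (hef ⟨x, hle₂.1 hx⟩).trans (hle₂.2 (x := ⟨x, hx⟩) rfl).symm
    exact this ▸ (e₂ ⟨x, hx⟩).2

end LinearMap.BilinForm
-- Dimension is the height in the subspace lattice, hence an order invariant.
theorem OrderIso.finrank_submodule_apply {F V : Type*} [Field F] [AddCommGroup V] [Module F V]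
    [FiniteDimensional F V] (Φ : Submodule F V ≃o Submodule F V) (X : Submodule F V) :
    finrank F (Φ X) = finrank F X := by
  have h := Order.height_orderIso Φ X
  rw [← Module.length_submodule, ← Module.length_submodule, Module.length_eq_finrank,
    Module.length_eq_finrank] at h
  exact_mod_cast h

/-! ### The symplectic form and the type of a subspace -/

namespace SympInnerProduct

variable {ν : ℕ} {F : Type*} [Field F]

/-- The symplectic inner product as a bilinear form. -/
noncomputable def sipForm (ν : ℕ) (F : Type*) [Field F] : BilinForm F (Idx ν → F) :=
  Matrix.toBilin' (K ν F)

theorem sipForm_apply (a b : Idx ν → F) : sipForm ν F a b = sip a b :=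
  Matrix.toBilin'_apply' _ _ _

theorem isAlt_sipForm : (sipForm ν F).IsAlt := fun a => (sipForm_apply a a).trans (sip_self a)

theorem K_mul_K : K ν F * K ν F = -1 := by
  simp [K, Matrix.fromBlocks_multiply, ← Matrix.fromBlocks_one, Matrix.fromBlocks_neg]

theorem ker_sipForm : LinearMap.ker (sipForm ν F) = ⊥ := by
  rw [LinearMap.ker_eq_bot']
  intro a ha
  refine dotProduct_eq_zero _ fun c => ?_
  -- Since `K² = -1`, pairing `a` with `K (-c)` gives the dot product of `a` and `c`.
  have h : sip a (K ν F *ᵥ (-c)) = 0 := by rw [← sipForm_apply, ha]; rfl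
  rwa [sip, Matrix.mulVec_mulVec, K_mul_K, Matrix.neg_mulVec, Matrix.one_mulVec, neg_neg] at h

theorem nondegenerate_sipForm : (sipForm ν F).Nondegenerate :=
  (LinearMap.IsRefl.nondegenerate_iff_separatingLeft
    (B := sipForm ν F) fun a b => isAlt_sipForm.isRefl a b).2
    (LinearMap.separatingLeft_iff_ker_eq_bot.2 ker_sipForm)

/-- In coordinates with respect to the chosen basis, the kernel of the Gram matrix is the radical;
the rest is rank-nullity. -/
theorem rank_gram_repMatrix (X : Submodule F (Idx ν → F)) :
    (repMatrix X * K ν F * (repMatrix X)ᵀ).rank +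
      finrank F (X ⊓ (sipForm ν F).orthogonal X : Submodule F (Idx ν → F)) = finrank F X := by
  rw [← LinearMap.BilinForm.finrank_ker_restrict isAlt_sipForm]
  let b := Module.finBasis F X
  have hrow : ∀ v, (repMatrix X)ᵀ *ᵥ v = (b.equivFun.symm v : Idx ν → F) := by
    intro v
    ext j
    simp [b, Basis.equivFun_symm_apply, Matrix.mulVec, dotProduct, repMatrix, mul_comm]
  have hker : LinearMap.ker (repMatrix X * K ν F * (repMatrix X)ᵀ).mulVecLin =
      (LinearMap.ker ((sipForm ν F).restrict X)).map b.equivFun.toLinearMap := by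
    rw [Submodule.map_equiv_eq_comap_symm]
    ext v
    have hG : ∀ i, ((repMatrix X * K ν F * (repMatrix X)ᵀ) *ᵥ v) i =
        sip (b i : Idx ν → F) (b.equivFun.symm v : Idx ν → F) := fun i => by
      rw [← Matrix.mulVec_mulVec, ← Matrix.mulVec_mulVec, hrow]
      rfl
    rw [LinearMap.mem_ker, Submodule.mem_comap, LinearMap.mem_ker, Matrix.mulVecLin_apply]
    constructor
    · intro h
      refine b.ext fun i => (sipForm_apply _ _).trans ?_
      rw [← sip_neg]
      exact neg_eq_zero.2 ((hG i).symm.trans (congrFun h i))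
    · intro h
      ext i
      rw [hG, ← sip_neg, neg_eq_zero.2]
      · rfl
      · exact (sipForm_apply _ _).symm.trans (LinearMap.congr_fun h (b i))
  have h := LinearMap.finrank_range_add_finrank_ker
    (repMatrix X * K ν F * (repMatrix X)ᵀ).mulVecLin
  rw [hker, LinearEquiv.finrank_map_eq, Module.finrank_fin_fun] at h
  exact h

/-- The Gram rank is even, so halving it in `t` loses nothing. -/
theorem t_eq_iff (X Y : Submodule F (Idx ν → F)) :
    t X = t Y ↔ finrank F X = finrank F Y ∧
      finrank F (X ⊓ (sipForm ν F).orthogonal X : Submodule F (Idx ν → F)) =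
        finrank F (Y ⊓ (sipForm ν F).orthogonal Y : Submodule F (Idx ν → F)) := by
  have hX := rank_gram_repMatrix X
  have hY := rank_gram_repMatrix Y
  have eX := Nat.div_two_mul_two_of_even (even_rank_gram (repMatrix X))
  have eY := Nat.div_two_mul_two_of_even (even_rank_gram (repMatrix Y))
  rw [t, t, Prod.mk.injEq]
  constructor <;> rintro ⟨h₁, h₂⟩ <;> exact ⟨h₁, by omega⟩

/-- A linear isometry acts on the graph. -/
def autOfIsometry (e : (Idx ν → F) ≃ₗ[F] (Idx ν → F))
    (he : ∀ x y, sipForm ν F (e x) (e y) = sipForm ν F x y) : AutSpi ν F where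
  toEquiv := (Submodule.orderIsoMapComap e).toEquiv.subtypeEquiv fun X =>
    and_congr (map_eq_bot_iff (Submodule.orderIsoMapComap e)).symm.not
      (map_eq_top_iff (Submodule.orderIsoMapComap e)).symm.not
  map_rel_iff' := by
    intro A B
    constructor
    · intro h a ha b hb
      rw [← sipForm_apply, ← he, sipForm_apply]
      exact h _ ⟨a, ha, rfl⟩ _ ⟨b, hb, rfl⟩
    · rintro h _ ⟨a, ha, rfl⟩ _ ⟨b, hb, rfl⟩
      have := he a b
      rw [sipForm_apply, sipForm_apply] at this
      exact this.trans (h a ha b hb)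

theorem exists_aut_of_t_eq {X₁ X₂ Y₁ Y₂ : Vertex ν F} (hX : Adj X₁ X₂) (hY : Adj Y₁ Y₂)
    (h₁ : t X₁.1 = t Y₁.1) (h₂ : t X₂.1 = t Y₂.1) (hsup : t (X₁.1 ⊔ X₂.1) = t (Y₁.1 ⊔ Y₂.1)) :
    ∃ σ : AutSpi ν F, σ X₁ = Y₁ ∧ σ X₂ = Y₂ := by
  rw [t_eq_iff] at h₁ h₂ hsup
  have hdX := Submodule.finrank_sup_add_finrank_inf_eq X₁.1 X₂.1
  have hdY := Submodule.finrank_sup_add_finrank_inf_eq Y₁.1 Y₂.1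
  obtain ⟨e, he, he₁, he₂⟩ := LinearMap.BilinForm.exists_isometry_map_eq_of_orthogonal
    isAlt_sipForm ker_sipForm (fun x hx y hy => (sipForm_apply x y).trans (hX x hx y hy))
    (fun x hx y hy => (sipForm_apply x y).trans (hY x hx y hy)) h₁.1 h₂.1 (by omega) h₁.2 h₂.2
  exact ⟨autOfIsometry e he, Subtype.ext he₁, Subtype.ext he₂⟩

/-! ### Graph automorphisms preserve types -/

/-- The vertex `A^⊥`. -/
noncomputable def perp (A : Vertex ν F) : Vertex ν F :=
  ⟨(sipForm ν F).orthogonal A.1, by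
    have h := LinearMap.BilinForm.orthogonal_orthogonal nondegenerate_sipForm isAlt_sipForm.isRefl
      A.1
    constructor
    · intro h0
      rw [h0, LinearMap.BilinForm.orthogonal_bot] at h
      exact A.2.2 h.symm
    · intro h0
      have h' := LinearMap.BilinForm.orthogonal_orthogonal nondegenerate_sipForm
        isAlt_sipForm.isRefl (⊥ : Submodule F (Idx ν → F))
      rw [LinearMap.BilinForm.orthogonal_bot] at h'
      rw [h0, h'] at h
      exact A.2.1 h.symm⟩

theorem perp_perp (A : Vertex ν F) : perp (perp A) = A :=
  Subtype.ext (LinearMap.BilinForm.orthogonal_orthogonal nondegenerate_sipForm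
    isAlt_sipForm.isRefl A.1)

theorem le_perp_iff {A B : Vertex ν F} : B ≤ perp A ↔ Adj A B :=
  ⟨fun h a ha b hb => (sipForm_apply a b).symm.trans (h hb a ha),
    fun h b hb a ha => (sipForm_apply a b).trans (h a ha b hb)⟩

theorem le_iff_adj_imp {A C : Vertex ν F} : A ≤ C ↔ ∀ B, Adj C B → Adj A B := by
  constructor
  · exact fun h B hB a ha b hb => hB a (h ha) b hb
  · intro h
    -- It is enough to test the single neighbour `B = C^⊥`.
    rw [← perp_perp C, le_perp_iff]
    exact (adj_symm ν F).symm _ _ (h _ (le_perp_iff.1 le_rfl))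

theorem aut_le_iff (σ : AutSpi ν F) {A C : Vertex ν F} : σ A ≤ σ C ↔ A ≤ C := by
  rw [le_iff_adj_imp, le_iff_adj_imp, σ.surjective.forall]
  simp only [σ.map_rel_iff]

theorem aut_perp (σ : AutSpi ν F) (A : Vertex ν F) : σ (perp A) = perp (σ A) := by
  refine eq_of_forall_le_iff fun B => ?_
  obtain ⟨B, rfl⟩ := σ.surjective B
  rw [aut_le_iff, le_perp_iff, le_perp_iff, σ.map_rel_iff]

open Classical in
/-- The action of a graph automorphism on the lattice of all subspaces, fixing `0` and the whole
space. -/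
noncomputable def latticeAut (σ : AutSpi ν F) :
    Submodule F (Idx ν → F) ≃o Submodule F (Idx ν → F) where
  toEquiv := Equiv.Perm.ofSubtype σ.toEquiv
  map_rel_iff' := by
    intro X Y
    set Φ : Equiv.Perm (Submodule F (Idx ν → F)) := Equiv.Perm.ofSubtype σ.toEquiv with hΦ
    have hbot : Φ ⊥ = ⊥ := Equiv.Perm.ofSubtype_apply_of_not_mem _ (by simp)
    have htop : Φ ⊤ = ⊤ := Equiv.Perm.ofSubtype_apply_of_not_mem _ (by simp)
    rcases eq_or_ne X ⊥ with rfl | hXb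
    · simp [hbot]
    rcases eq_or_ne Y ⊤ with rfl | hYt
    · simp [htop]
    rcases eq_or_ne X ⊤ with rfl | hXt
    · rw [htop, top_le_iff, top_le_iff, ← Φ.injective.eq_iff (a := Y), htop]
    rcases eq_or_ne Y ⊥ with rfl | hYb
    · rw [hbot, le_bot_iff, le_bot_iff, ← Φ.injective.eq_iff (a := X), hbot]
    have hX : Φ X = σ ⟨X, hXb, hXt⟩ := Equiv.Perm.ofSubtype_apply_of_mem _ _
    have hY : Φ Y = σ ⟨Y, hYb, hYt⟩ := Equiv.Perm.ofSubtype_apply_of_mem _ _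
    rw [hX, hY]
    exact aut_le_iff σ

theorem latticeAut_coe (σ : AutSpi ν F) (A : Vertex ν F) : latticeAut σ A.1 = (σ A).1 := by
  classical
  exact Equiv.Perm.ofSubtype_apply_coe σ.toEquiv A

/-- The radical is built from meet and perp, both respected by the automorphism. The zero and full
subspaces are fixed, and treated apart because perp is compared on vertices only. -/
theorem t_latticeAut (σ : AutSpi ν F) (X : Submodule F (Idx ν → F)) : t (latticeAut σ X) = t X := by
  rcases eq_or_ne X ⊥ with rfl | hb
  · rw [map_bot]
  rcases eq_or_ne X ⊤ with rfl | ht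
  · rw [map_top]
  rw [t_eq_iff]
  refine ⟨OrderIso.finrank_submodule_apply _ X, ?_⟩
  have h : (sipForm ν F).orthogonal (latticeAut σ X) =
      latticeAut σ ((sipForm ν F).orthogonal X) := by
    have h1 := latticeAut_coe σ ⟨X, hb, ht⟩
    have h2 := latticeAut_coe σ (perp ⟨X, hb, ht⟩)
    rw [aut_perp] at h2
    exact (congrArg _ h1).trans h2.symm
  rw [h, ← map_inf, OrderIso.finrank_submodule_apply]

theorem mem_orbit_mkEdge_iff {X₁ X₂ Y₁ Y₂ : Vertex ν F} (hX : Adj X₁ X₂) (hY : Adj Y₁ Y₂) :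
    mkEdge hY ∈ MulAction.orbit (AutSpi ν F) (mkEdge hX) ↔
      ∃ σ : AutSpi ν F, (σ X₁ = Y₁ ∧ σ X₂ = Y₂) ∨ (σ X₁ = Y₂ ∧ σ X₂ = Y₁) := by
  rw [MulAction.mem_orbit_iff]
  exact exists_congr fun σ => Subtype.ext_iff.trans Sym2.eq_iff

end SympInnerProduct

theorem theorem3 (ν : ℕ) (F : Type*) [Field F] [Finite F]
    (X₁ X₂ Y₁ Y₂ : SympInnerProduct.Vertex ν F)
    (hX : SympInnerProduct.Adj X₁ X₂) (hY : SympInnerProduct.Adj Y₁ Y₂) :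
    SympInnerProduct.mkEdge hY ∈
        MulAction.orbit (SympInnerProduct.AutSpi ν F) (SympInnerProduct.mkEdge hX) ↔
      (SympInnerProduct.t X₁.1 = SympInnerProduct.t Y₁.1 ∧
        SympInnerProduct.t X₂.1 = SympInnerProduct.t Y₂.1 ∧
        SympInnerProduct.t (X₁.1 ⊔ X₂.1) = SympInnerProduct.t (Y₁.1 ⊔ Y₂.1)) ∨
      (SympInnerProduct.t X₁.1 = SympInnerProduct.t Y₂.1 ∧
        SympInnerProduct.t X₂.1 = SympInnerProduct.t Y₁.1 ∧
        SympInnerProduct.t (X₁.1 ⊔ X₂.1) = SympInnerProduct.t (Y₁.1 ⊔ Y₂.1)) := by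
  rw [SympInnerProduct.mem_orbit_mkEdge_iff]
  have hinv : ∀ (σ : SympInnerProduct.AutSpi ν F) (A B : SympInnerProduct.Vertex ν F),
      SympInnerProduct.t A.1 = SympInnerProduct.t (σ A).1 ∧
      SympInnerProduct.t B.1 = SympInnerProduct.t (σ B).1 ∧
      SympInnerProduct.t (A.1 ⊔ B.1) = SympInnerProduct.t ((σ A).1 ⊔ (σ B).1) := fun σ A B => by
    simp only [← SympInnerProduct.latticeAut_coe, ← map_sup, SympInnerProduct.t_latticeAut,
      and_self]
  constructor
  · rintro ⟨σ, ⟨rfl, rfl⟩ | ⟨rfl, rfl⟩⟩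
    · exact Or.inl (hinv σ X₁ X₂)
    · exact Or.inr (sup_comm (σ X₁).1 (σ X₂).1 ▸ hinv σ X₁ X₂)
  · rintro (⟨h₁, h₂, h⟩ | ⟨h₁, h₂, h⟩)
    · obtain ⟨σ, hσ⟩ := SympInnerProduct.exists_aut_of_t_eq hX hY h₁ h₂ h
      exact ⟨σ, Or.inl hσ⟩
    -- The second alternative is the first one for the reversed edge `Y₂`---`Y₁`.
    · obtain ⟨σ, hσ⟩ := SympInnerProduct.exists_aut_of_t_eq hX
        ((SympInnerProduct.adj_symm ν F).symm _ _ hY) h₁ h₂ (by rw [h, sup_comm])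
      exact ⟨σ, Or.inr hσ⟩
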